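/- Let $n\ge 1$ and consider the $n$-node directed ring with nodes $\mathbb{Z}_n$ and arcs $(v,v+1)$. A single-round one-way quantum distributed algorithm for $3$-coloring is given by numbers $w,m\ge 0$, a unitary $U$ on $\mathcal{H}=(\mathbb{C}^2)^{\otimes w}\otimes(\mathbb{C}^2)^{\otimes m}$, and a projective measurement $\{\Pi_\sigma\}_{\sigma\in\{0,1,2\}}$ on $\mathcal{H}$ (mutually orthogonal orthogonal projectors with $\sum_\sigma\Pi_\sigma=I$), all the same for every node. Each node $v$ holds a register with space $\mathcal{H}$, consisting of a workspace register of $w$ qubits and a message register of $m$ qubits, all initialized to $|0\rangle$; write $|\mathbf{0}\rangle$ for this initial state of one node. Every node applies $U$; then one round of communication takes place, in which every message register is sent to the succeeding node, i.e. the unitary $V$ with \[ V\colon \bigotimes_{v\in\mathbb{Z}_n}|b_v,c_v\rangle\mapsto\bigotimes_{v\in\mathbb{Z}_n}|b_v,c_{v-1}\rangle \] is applied, where $b_v$ refers to the workspace and $c_v$ to the message; finally every node measures its register with $\{\Pi_\sigma\}$ and outputs the outcome as its color. Thus a coloring $\phi\colon\mathbb{Z}_n\to\{0,1,2\}$ is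 output with probability \[ \Pr[\Phi=\phi]=\Big\|\Big(\bigotimes_{v\in\mathbb{Z}_n}\Pi_{\phi(v)}\Big)\,V\,U^{\otimes n}\,|\mathbf{0}\rangle^{\otimes n}\Big\|^2 . \] A coloring $\phi$ is proper if $\phi(v)\ne\phi(v+1)$ for all $v\in\mathbb{Z}_n$. Theorem. For every $n\ge 1$ and every single-round one-way quantum distributed algorithm as above, the probability that its output $\Phi$ is a proper $3$-coloring of the $n$-node ring satisfies \[ \Pr[\Phi\text{ is proper}]\le\left(\tfrac{1382}{1383}\right)^{\lfloor n/16\rfloor}. \] -/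

import Mathlib

/-! Quantum one-way distributed algorithms on the directed ring with node set `ZMod n`.
States and operators on registers are written in coordinates with respect to the computational
basis: a register whose computational basis is `B` carries the space `B → ℂ`, a family of such
registers indexed by `ι` carries the tensor product space `(ι → B) → ℂ`, and an operator is
the matrix of its coefficients. -/

noncomputable section

namespace OneWayRing

open scoped Matrix

/-- Computational basis of a node register consisting of a workspace register of `w` qubits and
a message register of `m` qubits. -/
abbrev NodeBasis (w m : ℕ) : Type := (Fin w → Fin 2) × (Fin m → Fin 2)

/-- A (uniform) one-way distributed quantum algorithm with output colors in `C`: every node holds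
`w` workspace qubits and `m` message qubits, applies the unitary `U` before every round of
communication, and finally performs the projective measurement `(P c)_c`. -/
structure Algorithm (C : Type*) [Fintype C] where
  w : ℕ
  m : ℕ
  U : Matrix (NodeBasis w m) (NodeBasis w m) ℂ
  unitary_U : U ∈ Matrix.unitaryGroup (NodeBasis w m) ℂ
  P : C → Matrix (NodeBasis w m) (NodeBasis w m) ℂ
  isStarProjection_P : ∀ c, IsStarProjection (P c)
  orthogonal_P : ∀ c c', c ≠ c' → P c * P c' = 0
  sum_P : ∑ c, P c = 1

/-- The tensor product `⨂ v, A v` of operators on the individual registers. -/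
def tensorOp {ι B : Type*} [Fintype ι] (A : ι → Matrix B B ℂ) : Matrix (ι → B) (ι → B) ℂ :=
  Matrix.of fun x y => ∏ v, A v (x v) (y v)

/-- The effect of one round of communication on computational basis states: each node keeps its
workspace and receives the message register of the node preceding it. -/
def passMessages {n w m : ℕ} (x : ZMod n → NodeBasis w m) : ZMod n → NodeBasis w m :=
  fun v => ((x v).1, (x (v - 1)).2)

/-- The messaging unitary, `⨂ v |b_v, c_v⟩ ↦ ⨂ v |b_v, c_{v-1}⟩`. -/
def messagingOp (n w m : ℕ) [NeZero n] :
    Matrix (ZMod n → NodeBasis w m) (ZMod n → NodeBasis w m) ℂ :=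
  Matrix.of fun x y => if x = passMessages y then 1 else 0

/-- The initial state: all qubits of all nodes are `|0⟩`. -/
def initialState (n w m : ℕ) [NeZero n] : (ZMod n → NodeBasis w m) → ℂ :=
  Pi.single (fun _ => (fun _ => 0, fun _ => 0)) 1

namespace Algorithm

variable {C : Type*} [Fintype C] (𝒜 : Algorithm C)

/-- The state right before the final measurement of the `r`-round protocol on the `n`-node ring,
`(V U^{⊗n})^r |0⟩^{⊗n}`. -/
def finalState (n r : ℕ) [NeZero n] : (ZMod n → NodeBasis 𝒜.w 𝒜.m) → ℂ :=
  ((messagingOp n 𝒜.w 𝒜.m * tensorOp fun _ : ZMod n => 𝒜.U) ^ r) *ᵥ initialState n 𝒜.w 𝒜.m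

/-- The probability that the `r`-round protocol outputs the coloring `φ`, namely
`‖(⨂ v, P (φ v)) (V U^{⊗n})^r |0⟩^{⊗n}‖²`. -/
def outputProb (n r : ℕ) [NeZero n] (φ : ZMod n → C) : ℝ :=
  ∑ x, ‖((tensorOp fun v => 𝒜.P (φ v)) *ᵥ 𝒜.finalState n r) x‖ ^ 2

end Algorithm

/-- A coloring of the ring is proper if adjacent nodes have different colors. -/
def IsProper {n : ℕ} {C : Type*} (φ : ZMod n → C) : Prop :=
  ∀ v, φ v ≠ φ (v + 1)

open Classical in
/-- The probability that the `r`-round protocol on the `n`-node ring outputs a proper coloring. -/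
def Algorithm.successProb {C : Type*} [Fintype C] (𝒜 : Algorithm C) (n r : ℕ) [NeZero n] : ℝ :=
  ∑ φ : ZMod n → C with IsProper φ, 𝒜.outputProb n r φ

end OneWayRing

end

open scoped Matrix

namespace OneWayRing

/-! ### One-dependent word probabilities -/

/-! Writing each node's contribution as a transfer matrix on (bra, ket) index pairs, the probability
of a coloring of the ring is the trace of a product of transfer matrices. Since the projectors sum
to the identity, the sum of the transfer matrices over all colors has rank one (`sum_transfer`).
Forgetting one node thus cuts the ring open, and forgetting one node of a stretch makes its two
sides independent: outputs form a stationary one-dependent process (`isOneDependent_wordProb`).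

For such a process, forgetting every third letter bounds the probability of a proper stretch by a
power of that of a proper pair (`properProb_le_pow`). Some color has probability at least 1/3. If it
almost never followed itself, a recursion would make the probability of avoiding it at five
consecutive places negative (`le_repeat_of_third_le`). Hence a pair is improper with probability at
least 1/1383. -/

/-- The sum of `f` over all words of length `k`. -/
def sumWords {C : Type*} [Fintype C] : ℕ → (List C → ℝ) → ℝ
  | 0, f => f []
  | k + 1, f => ∑ c, sumWords k fun l => f (c :: l)

theorem sumWords_eq_sum_ofFn {C : Type*} [Fintype C] (k : ℕ) (f : List C → ℝ) :
    sumWords k f = ∑ φ : Fin k → C, f (List.ofFn φ) := by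
  induction k generalizing f with
  | zero => simp [sumWords]
  | succ k ih =>
    rw [sumWords, ← (Fin.consEquiv fun _ : Fin (k + 1) => C).sum_comp, Fintype.sum_prod_type]
    refine Finset.sum_congr rfl fun c _ => ?_
    rw [ih]
    refine Finset.sum_congr rfl fun φ _ => ?_
    simp [Fin.consEquiv, List.ofFn_succ]

theorem sumWords_mono {C : Type*} [Fintype C] (k : ℕ) {f g : List C → ℝ} (h : ∀ l, f l ≤ g l) :
    sumWords k f ≤ sumWords k g := by
  rw [sumWords_eq_sum_ofFn, sumWords_eq_sum_ofFn]
  exact Finset.sum_le_sum fun φ _ => h _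

theorem sumWords_sum {C ι : Type*} [Fintype C] (k : ℕ) (s : Finset ι) (f : ι → List C → ℝ) :
    sumWords k (fun l => ∑ i ∈ s, f i l) = ∑ i ∈ s, sumWords k (f i) := by
  simp only [sumWords_eq_sum_ofFn]
  exact Finset.sum_comm

theorem sumWords_const_mul {C : Type*} [Fintype C] (k : ℕ) (a : ℝ) (f : List C → ℝ) :
    sumWords k (fun l => a * f l) = a * sumWords k f := by
  simp only [sumWords_eq_sum_ofFn, Finset.mul_sum]

/-- The probabilities of finding given words at consecutive places of a stationary one-dependent
process: summing over the letter at one place makes the two sides independent. -/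
structure IsOneDependent {C : Type*} [Fintype C] (p : List C → ℝ) : Prop where
  nonneg : ∀ l, 0 ≤ p l
  nil : p [] = 1
  sum_append : ∀ l l', ∑ c, p (l ++ c :: l') = p l * p l'

open Classical in
/-- The probability that a stretch of length `k` is properly colored. -/
noncomputable def properProb {C : Type*} [Fintype C] (p : List C → ℝ) (k : ℕ) : ℝ :=
  sumWords k fun l => if l.IsChain (· ≠ ·) then p l else 0

namespace IsOneDependent

variable {C : Type*} [Fintype C] {p : List C → ℝ}

theorem sum_cons (hp : IsOneDependent p) (l : List C) : ∑ c, p (c :: l) = p l := by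
  simpa [hp.nil] using hp.sum_append [] l

theorem sumWords_eq_one (hp : IsOneDependent p) (k : ℕ) : sumWords k p = 1 := by
  induction k with
  | zero => exact hp.nil
  | succ k ih => rw [sumWords, ← sumWords_sum]; simpa only [hp.sum_cons] using ih

theorem properProb_nonneg (hp : IsOneDependent p) (k : ℕ) : 0 ≤ properProb p k := by
  rw [properProb, sumWords_eq_sum_ofFn]
  refine Finset.sum_nonneg fun φ _ => ?_
  split_ifs
  exacts [hp.nonneg _, le_rfl]

theorem properProb_le_one (hp : IsOneDependent p) (k : ℕ) : properProb p k ≤ 1 := by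
  rw [← hp.sumWords_eq_one k]
  refine sumWords_mono k fun l => ?_
  split_ifs
  exacts [le_rfl, hp.nonneg _]

open Classical in
theorem properProb_two : properProb p 2 = ∑ a, ∑ b, if a ≠ b then p [a, b] else 0 := by
  simp [properProb, sumWords]

-- Forgetting the third letter, together with the constraints on both sides of it, decouples the
-- first two letters from the rest.
open Classical in
theorem properProb_add_three_le (hp : IsOneDependent p) (k : ℕ) :
    properProb p (k + 3) ≤ properProb p 2 * properProb p k := by
  rw [properProb_two, Finset.sum_mul]
  simp only [Finset.sum_mul]
  change ∑ a, ∑ b, ∑ c, sumWords k _ ≤ _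
  refine Finset.sum_le_sum fun a _ => Finset.sum_le_sum fun b _ => ?_
  rw [properProb, ← sumWords_const_mul, ← sumWords_sum]
  refine sumWords_mono k fun l => ?_
  have key := hp.sum_append [a, b] l
  by_cases hab : a ≠ b
  · by_cases hl : l.IsChain (· ≠ ·)
    · rw [if_pos hab, if_pos hl, ← key]
      refine Finset.sum_le_sum fun c _ => ?_
      beta_reduce
      split_ifs
      exacts [le_rfl, hp.nonneg _]
    · rw [if_neg hl, mul_zero]
      refine (Finset.sum_eq_zero fun c _ => if_neg fun h => hl ?_).le
      exact h.tail.tail.tail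
  · rw [if_neg hab, zero_mul]
    refine (Finset.sum_eq_zero fun c _ => if_neg fun h => hab ?_).le
    exact (List.isChain_cons_cons.1 h).1

theorem properProb_le_pow (hp : IsOneDependent p) (j : ℕ) {k : ℕ} (h : 3 * j ≤ k) :
    properProb p k ≤ properProb p 2 ^ j := by
  induction j generalizing k with
  | zero => simpa using hp.properProb_le_one k
  | succ j ih =>
    obtain ⟨k, rfl⟩ : ∃ i, k = i + 3 := ⟨k - 3, by omega⟩
    rw [pow_succ']
    exact (hp.properProb_add_three_le k).trans
      (mul_le_mul_of_nonneg_left (ih (by omega)) (hp.properProb_nonneg 2))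

end IsOneDependent

open Classical in
/-- The probability of a word preceded by `k` letters different from `a`. -/
noncomputable def avoidProb {C : Type*} [Fintype C] (p : List C → ℝ) (a : C) : ℕ → List C → ℝ
  | 0, l => p l
  | k + 1, l => ∑ c with c ≠ a, avoidProb p a k (c :: l)

/-! ### Avoiding a color, and the forced repetition of a frequent one -/

namespace IsOneDependent

variable {C : Type*} [Fintype C] {p : List C → ℝ}

theorem avoidProb_nonneg (hp : IsOneDependent p) (a : C) (k : ℕ) (l : List C) :
    0 ≤ avoidProb p a k l := by
  induction k generalizing l with
  | zero => exact hp.nonneg l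
  | succ k ih => exact Finset.sum_nonneg fun c _ => ih _

theorem avoidProb_le (hp : IsOneDependent p) (a : C) (k : ℕ) (l : List C) :
    avoidProb p a k l ≤ p l := by
  induction k generalizing l with
  | zero => exact le_rfl
  | succ k ih =>
    rw [← hp.sum_cons l]
    exact (Finset.sum_le_sum fun c _ => ih (c :: l)).trans
      (Finset.sum_le_univ_sum_of_nonneg fun c => hp.nonneg _)

theorem sum_avoidProb_append (hp : IsOneDependent p) (a : C) (k : ℕ) (l l' : List C) :
    ∑ c, avoidProb p a k (l ++ c :: l') = avoidProb p a k l * p l' := by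
  induction k generalizing l with
  | zero => exact hp.sum_append l l'
  | succ k ih =>
    simp only [avoidProb]
    rw [Finset.sum_comm, Finset.sum_mul]
    exact Finset.sum_congr rfl fun d _ => ih (d :: l)

/-- The letter just before `l` avoids `a`: sum over all its values, which decouples the two sides,
and subtract the value `a`. -/
theorem avoidProb_succ (hp : IsOneDependent p) (a : C) (k : ℕ) (l : List C) :
    avoidProb p a (k + 1) l = avoidProb p a k [] * p l - avoidProb p a k (a :: l) := by
  classical
  rw [← hp.sum_avoidProb_append a k [] l, eq_sub_iff_add_eq, avoidProb, Finset.filter_ne',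
    add_comm]
  exact Finset.add_sum_erase Finset.univ (fun c => avoidProb p a k (c :: l)) (Finset.mem_univ a)

/-- The last term is at most `p [a, a]`, so this is a linear recursion in `k` up to a small error.
-/
theorem avoidProb_add_two_nil (hp : IsOneDependent p) (a : C) (k : ℕ) :
    avoidProb p a (k + 2) [] =
      avoidProb p a (k + 1) [] - p [a] * avoidProb p a k [] + avoidProb p a k [a, a] := by
  rw [hp.avoidProb_succ a (k + 1), hp.avoidProb_succ a k [a], hp.nil]
  ring

theorem le_repeat_of_third_le (hp : IsOneDependent p) {a : C} (ha : 1 / 3 ≤ p [a]) :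
    1 / 1383 ≤ p [a, a] := by
  by_contra! he
  have q0 : avoidProb p a 0 [] = 1 := hp.nil
  have q1 := hp.avoidProb_succ a 0 []
  have q2 := hp.avoidProb_add_two_nil a 0
  have q3 := hp.avoidProb_add_two_nil a 1
  have q4 := hp.avoidProb_add_two_nil a 2
  have q5 := hp.avoidProb_add_two_nil a 3
  have e0 : avoidProb p a 0 [a, a] = p [a, a] := rfl
  have ea : avoidProb p a 0 [a] = p [a] := rfl
  have e1 := hp.avoidProb_le a 1 [a, a]
  have e2 := hp.avoidProb_le a 2 [a, a]
  have e3 := hp.avoidProb_le a 3 [a, a]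
  have n1 := hp.avoidProb_nonneg a 1 [a, a]
  have n2 := hp.avoidProb_nonneg a 2 [a, a]
  have n3 := hp.avoidProb_nonneg a 3 [a, a]
  have h2 := hp.avoidProb_nonneg a 2 []
  have h5 := hp.avoidProb_nonneg a 5 []
  have hn := hp.nonneg [a, a]
  norm_num only at q1 q2 q3 q4 q5
  rw [q0, ea, hp.nil] at q1
  rw [q1, q0, e0] at q2
  rw [q2, q1] at q3
  rw [q3, q2] at q4
  rw [q4, q3] at q5
  rw [q2] at h2
  rw [q5] at h5
  generalize avoidProb p a 1 [a, a] = x at *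
  generalize avoidProb p a 2 [a, a] = y at *
  generalize avoidProb p a 3 [a, a] = z at *
  generalize p [a, a] = e at *
  generalize p [a] = t at *
  -- This is the nonnegativity `h2`, now reading `1 - 2 * t + e ≥ 0` with `e` small.
  have ht : t ≤ 51 / 100 := by linarith
  have hx : 0 ≤ t * x := mul_nonneg (by linarith) n1
  have hte : 0 ≤ t * e := mul_nonneg (by linarith) hn
  -- The recursion without errors gives this cubic for five places; it equals -1/27 at `t = 1/3`.
  have hf : 1 - 5 * t + 6 * t ^ 2 - t ^ 3 ≤ -(1 / 27) := by
    nlinarith [mul_nonneg (sub_nonneg.2 ha) (sub_nonneg.2 ht),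
      mul_nonneg (mul_nonneg (sub_nonneg.2 ha) (sub_nonneg.2 ht)) (sub_nonneg.2 ha)]
  -- The errors add up to at most `4 * e`, so `e < 1/108` would already contradict `h5`.
  nlinarith

theorem properProb_two_le {p : List (Fin 3) → ℝ} (hp : IsOneDependent p) :
    properProb p 2 ≤ 1382 / 1383 := by
  classical
  have h1 : ∑ a, p [a] = 1 := by rw [hp.sum_cons, hp.nil]
  obtain ⟨a, ha⟩ : ∃ a, 1 / 3 ≤ p [a] := by
    by_contra! h
    rw [Fin.sum_univ_three] at h1
    linarith [h 0, h 1, h 2]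
  have h2 : ∑ a, ∑ b, p [a, b] = 1 := hp.sumWords_eq_one 2
  have h3 : properProb p 2 + ∑ a, p [a, a] = 1 := by
    rw [properProb_two, ← h2, ← Finset.sum_add_distrib]
    refine Finset.sum_congr rfl fun a _ => ?_
    rw [← Finset.add_sum_erase Finset.univ (fun b => p [a, b]) (Finset.mem_univ a),
      ← Finset.filter_ne, Finset.sum_filter, add_comm]
    congr!
  have h4 : p [a, a] ≤ ∑ a, p [a, a] :=
    Finset.single_le_sum (f := fun a => p [a, a]) (fun b _ => hp.nonneg _) (Finset.mem_univ a)
  linarith [hp.le_repeat_of_third_le ha]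

end IsOneDependent

/-! ### Cyclic sums of products -/

theorem prod_ofFn_apply {R S : Type*} [CommSemiring R] [Fintype S] [DecidableEq S] (k : ℕ)
    (A : Fin (k + 1) → Matrix S S R) (s t : S) :
    (List.ofFn A).prod s t =
      ∑ z : Fin k → S, ∏ i, A i ((Fin.cons s z : Fin (k + 1) → S) i)
        ((Fin.snoc z t : Fin (k + 1) → S) i) := by
  induction k generalizing s with
  | zero => simp [Fin.snoc]
  | succ k ih =>
    rw [List.ofFn_succ, List.prod_cons, Matrix.mul_apply,
      ← (Fin.consEquiv fun _ : Fin (k + 1) => S).sum_comp, Fintype.sum_prod_type]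
    refine Finset.sum_congr rfl fun u _ => ?_
    rw [ih, Finset.mul_sum]
    refine Finset.sum_congr rfl fun z _ => ?_
    refine Eq.trans ?_ (Fin.prod_univ_succ _).symm
    simp only [Fin.consEquiv, Equiv.coe_fn_mk, Fin.cons_zero, Fin.cons_succ,
      ← Fin.cons_snoc_eq_snoc_cons]

theorem trace_prod_ofFn {R S : Type*} [CommSemiring R] [Fintype S] [DecidableEq S] (k : ℕ)
    (A : Fin (k + 1) → Matrix S S R) :
    (List.ofFn A).prod.trace = ∑ z : Fin (k + 1) → S, ∏ i, A i (z (i - 1)) (z i) := by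
  rw [← (Fin.snocEquiv fun _ : Fin (k + 1) => S).sum_comp, Fintype.sum_prod_type, Matrix.trace]
  refine Finset.sum_congr rfl fun s _ => ?_
  rw [Matrix.diag_apply, prod_ofFn_apply]
  refine Finset.sum_congr rfl fun z _ => Finset.prod_congr rfl fun i _ => ?_
  congr 1
  refine Fin.cases ?_ (fun j => ?_) i
  -- The predecessor of index 0 is the last index, which closes the path into a cycle.
  · have : (0 : Fin (k + 1)) - 1 = Fin.last k := by
      rw [sub_eq_iff_eq_add, Fin.last_add_one]
    simp [Fin.snocEquiv, this]
  · have : j.succ - 1 = j.castSucc := by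
      rw [sub_eq_iff_eq_add, Fin.coeSucc_eq_succ]
    simp [Fin.snocEquiv, this]

/-! ### Tensor products of operators -/

theorem tensorOp_mul {ι B : Type*} [Fintype ι] [DecidableEq ι] [Fintype B]
    (A A' : ι → Matrix B B ℂ) : tensorOp A * tensorOp A' = tensorOp fun v => A v * A' v := by
  ext x y
  simp only [tensorOp, Matrix.mul_apply, Matrix.of_apply, ← Finset.prod_mul_distrib]
  exact (Fintype.prod_sum fun v b => A v (x v) b * A' v b (y v)).symm

theorem conjTranspose_tensorOp {ι B : Type*} [Fintype ι] (A : ι → Matrix B B ℂ) :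
    (tensorOp A)ᴴ = tensorOp fun v => (A v)ᴴ := by
  ext x y
  simp [tensorOp]

/-! ### Transfer matrices of a single-round algorithm -/

namespace Algorithm

variable {C : Type*} [Fintype C] (𝒜 : Algorithm C)

/-- The state of a node after the unitary has been applied. -/
def nodeState : NodeBasis 𝒜.w 𝒜.m → ℂ :=
  fun b => 𝒜.U b (fun _ => 0, fun _ => 0)

theorem sum_star_mul_nodeState : ∑ b, star (𝒜.nodeState b) * 𝒜.nodeState b = 1 := by
  have h := congrFun₂ (Matrix.mem_unitaryGroup_iff'.1 𝒜.unitary_U)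
    (fun _ => 0, fun _ => 0) (fun _ => 0, fun _ => 0)
  simpa [Matrix.mul_apply, Matrix.star_apply, nodeState] using h

/-- The contribution of a node with output `c`, as a matrix between the indices (for bra and ket)
of the preceding node and its own. -/
def transfer (c : C) : Matrix (NodeBasis 𝒜.w 𝒜.m × NodeBasis 𝒜.w 𝒜.m)
    (NodeBasis 𝒜.w 𝒜.m × NodeBasis 𝒜.w 𝒜.m) ℂ :=
  Matrix.of fun s t => star (𝒜.nodeState t.1) * 𝒜.nodeState t.2 *
    𝒜.P c (t.1.1, s.1.2) (t.2.1, s.2.2)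

/-- The right end of a stretch of nodes: the message sent out is discarded. -/
def discardMessage : NodeBasis 𝒜.w 𝒜.m × NodeBasis 𝒜.w 𝒜.m → ℂ :=
  fun s => if s.1.2 = s.2.2 then 1 else 0

/-- The left end of a stretch of nodes: the workspace of the preceding node is discarded. -/
def discardWorkspace : NodeBasis 𝒜.w 𝒜.m × NodeBasis 𝒜.w 𝒜.m → ℂ :=
  fun t => star (𝒜.nodeState t.1) * 𝒜.nodeState t.2 * if t.1.1 = t.2.1 then 1 else 0

/-- The identity on a measured register factors into its own workspace and the message received from
the preceding node. -/
theorem sum_transfer :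
    ∑ c, 𝒜.transfer c = Matrix.vecMulVec 𝒜.discardMessage 𝒜.discardWorkspace := by
  ext s t
  have h : ∑ c, 𝒜.P c (t.1.1, s.1.2) (t.2.1, s.2.2) =
      if t.1.1 = t.2.1 ∧ s.1.2 = s.2.2 then 1 else 0 := by
    rw [← Matrix.sum_apply, 𝒜.sum_P, Matrix.one_apply]
    simp only [Prod.mk.injEq]
  simp only [Matrix.sum_apply, transfer, Matrix.of_apply, ← Finset.mul_sum, h,
    Matrix.vecMulVec_apply, discardMessage, discardWorkspace]
  by_cases h1 : t.1.1 = t.2.1 <;> by_cases h2 : s.1.2 = s.2.2 <;> simp [h1, h2]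

theorem discardWorkspace_dotProduct_discardMessage :
    𝒜.discardWorkspace ⬝ᵥ 𝒜.discardMessage = 1 := by
  rw [← 𝒜.sum_star_mul_nodeState, dotProduct, Fintype.sum_prod_type]
  refine Finset.sum_congr rfl fun b _ => ?_
  rw [Finset.sum_eq_single b]
  · simp [discardWorkspace, discardMessage]
  · intro b' _ hb
    have : ¬ (b.1 = b'.1 ∧ b.2 = b'.2) := fun h => hb (Prod.ext h.1.symm h.2.symm)
    simp only [discardWorkspace, discardMessage]
    by_cases h1 : b.1 = b'.1 <;> by_cases h2 : b.2 = b'.2 <;> simp_all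
  · simp

/-- The probability of a word of outputs at consecutive nodes. -/
def wordProb (l : List C) : ℝ :=
  (𝒜.discardWorkspace ⬝ᵥ ((l.map 𝒜.transfer).prod *ᵥ 𝒜.discardMessage)).re

/-! ### Output probabilities on the ring as traces -/

theorem finalState_one (n : ℕ) [NeZero n] :
    𝒜.finalState n 1 =
      messagingOp n 𝒜.w 𝒜.m *ᵥ fun y => ∏ v, 𝒜.nodeState (y v) := by
  rw [finalState, pow_one, ← Matrix.mulVec_mulVec]
  congr 1
  ext y
  simp [initialState, tensorOp, nodeState]

theorem messagingOp_mulVec_dotProduct {n w m : ℕ} [NeZero n]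
    (f g : (ZMod n → NodeBasis w m) → ℂ) :
    (messagingOp n w m *ᵥ f) ⬝ᵥ g = ∑ y, f y * g (passMessages y) := by
  simp only [dotProduct, Matrix.mulVec, messagingOp, Matrix.of_apply, Finset.sum_mul]
  rw [Finset.sum_comm]
  refine Finset.sum_congr rfl fun y _ => ?_
  simp

theorem outputProb_eq_dotProduct (n r : ℕ) [NeZero n] (φ : ZMod n → C) :
    (𝒜.outputProb n r φ : ℂ) = star (𝒜.finalState n r) ⬝ᵥ
      ((tensorOp fun v => 𝒜.P (φ v)) *ᵥ 𝒜.finalState n r) := by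
  have hP : (tensorOp fun v => 𝒜.P (φ v))ᴴ * (tensorOp fun v => 𝒜.P (φ v)) =
      tensorOp fun v => 𝒜.P (φ v) := by
    rw [conjTranspose_tensorOp, tensorOp_mul]
    congr 1
    funext v
    have h := 𝒜.isStarProjection_P (φ v)
    rw [← Matrix.star_eq_conjTranspose, h.isSelfAdjoint.star_eq, h.isIdempotentElem.eq]
  rw [← hP, ← Matrix.mulVec_mulVec, Matrix.dotProduct_mulVec, ← Matrix.star_mulVec, outputProb]
  push_cast
  refine Finset.sum_congr rfl fun x _ => ?_
  simp [Complex.conj_mul']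

theorem outputProb_one_eq_sum (n : ℕ) [NeZero n] (φ : ZMod n → C) :
    (𝒜.outputProb n 1 φ : ℂ) =
      ∑ z : ZMod n → NodeBasis 𝒜.w 𝒜.m × NodeBasis 𝒜.w 𝒜.m,
        ∏ v, 𝒜.transfer (φ v) (z (v - 1)) (z v) := by
  have hstar : star (messagingOp n 𝒜.w 𝒜.m *ᵥ fun y => ∏ v, 𝒜.nodeState (y v)) =
      messagingOp n 𝒜.w 𝒜.m *ᵥ fun y => ∏ v, star (𝒜.nodeState (y v)) := by
    ext x
    simp [Matrix.mulVec, dotProduct, messagingOp, apply_ite]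
  rw [outputProb_eq_dotProduct, finalState_one, hstar, messagingOp_mulVec_dotProduct,
    ← (Equiv.arrowProdEquivProdArrow (ZMod n) (fun _ => NodeBasis 𝒜.w 𝒜.m)
      (fun _ => NodeBasis 𝒜.w 𝒜.m)).symm.sum_comp, Fintype.sum_prod_type]
  refine Finset.sum_congr rfl fun y _ => ?_
  rw [Matrix.mulVec, dotProduct_comm, messagingOp_mulVec_dotProduct, Finset.mul_sum]
  refine Finset.sum_congr rfl fun y' _ => ?_
  simp only [tensorOp, Matrix.of_apply]
  rw [← Finset.prod_mul_distrib, ← Finset.prod_mul_distrib]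
  refine Finset.prod_congr rfl fun i _ => ?_
  rw [← mul_assoc]
  rfl

theorem outputProb_one_eq_trace (k : ℕ) (φ : ZMod (k + 1) → C) :
    (𝒜.outputProb (k + 1) 1 φ : ℂ) =
      (List.ofFn fun i : Fin (k + 1) => 𝒜.transfer (φ i)).prod.trace :=
  (𝒜.outputProb_one_eq_sum (k + 1) φ).trans
    (trace_prod_ofFn k fun i : Fin (k + 1) => 𝒜.transfer (φ i)).symm

/-- Such a trace is an output probability on the ring of length `l.length`. -/
theorem trace_prod_transfer (l : List C) (hl : l ≠ []) :
    ∃ x : ℝ, 0 ≤ x ∧ ((l.map 𝒜.transfer).prod.trace : ℂ) = x := by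
  obtain ⟨k, hk⟩ : ∃ k, l.length = k + 1 :=
    Nat.exists_eq_succ_of_ne_zero (by simpa using hl)
  obtain ⟨φ, rfl⟩ : ∃ φ : Fin (k + 1) → C, l = List.ofFn φ := by
    refine ⟨fun i => l.get (i.cast hk.symm), ?_⟩
    rw [← List.ofFn_congr hk, List.ofFn_get]
  refine ⟨𝒜.outputProb (k + 1) 1 φ, Finset.sum_nonneg fun x _ => by positivity, ?_⟩
  rw [List.map_ofFn]
  exact (𝒜.outputProb_one_eq_trace k φ).symm

/-- The rank-one sum cuts the cycle at the forgotten node; cyclicity of the trace then puts `l'`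
before `l`. -/
theorem sum_trace_append (l l' : List C) :
    ∑ c, (((l ++ c :: l').map 𝒜.transfer).prod).trace =
      𝒜.discardWorkspace ⬝ᵥ (((l' ++ l).map 𝒜.transfer).prod *ᵥ 𝒜.discardMessage) := by
  simp only [List.map_append, List.map_cons, List.prod_append, List.prod_cons]
  rw [← Matrix.trace_sum, ← Finset.mul_sum, ← Finset.sum_mul, sum_transfer, Matrix.trace_mul_comm,
    Matrix.mul_assoc, Matrix.vecMulVec_mul, Matrix.trace_vecMulVec, dotProduct_comm,
    ← Matrix.dotProduct_mulVec]

theorem coe_wordProb (l : List C) :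
    (𝒜.wordProb l : ℂ) =
      𝒜.discardWorkspace ⬝ᵥ ((l.map 𝒜.transfer).prod *ᵥ 𝒜.discardMessage) := by
  have h := 𝒜.sum_trace_append [] l
  choose x _ hx using fun c => 𝒜.trace_prod_transfer ([] ++ c :: l) (by simp)
  simp only [hx, List.append_nil] at h
  rw [wordProb, ← h, ← Complex.ofReal_sum, Complex.ofReal_re]

theorem wordProb_nonneg (l : List C) : 0 ≤ 𝒜.wordProb l := by
  have h := 𝒜.sum_trace_append [] l
  choose x hx0 hx using fun c => 𝒜.trace_prod_transfer ([] ++ c :: l) (by simp)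
  simp only [hx, List.append_nil] at h
  rw [wordProb, ← h, ← Complex.ofReal_sum, Complex.ofReal_re]
  exact Finset.sum_nonneg fun c _ => hx0 c

theorem isOneDependent_wordProb : IsOneDependent 𝒜.wordProb where
  nonneg := 𝒜.wordProb_nonneg
  nil := by simp [wordProb, discardWorkspace_dotProduct_discardMessage]
  sum_append l l' := by
    apply Complex.ofReal_injective
    push_cast
    simp only [coe_wordProb, List.map_append, List.map_cons, List.prod_append, List.prod_cons]
    rw [← dotProduct_sum, ← Matrix.sum_mulVec, ← Finset.mul_sum, ← Finset.sum_mul, sum_transfer,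
      ← Matrix.mulVec_mulVec, ← Matrix.mulVec_mulVec, Matrix.vecMulVec_mulVec,
      Matrix.mulVec_smul, op_smul_eq_smul, dotProduct_smul, smul_eq_mul, mul_comm]

/-- Node 0 is forgotten, leaving an open stretch of `k` nodes. -/
theorem successProb_one_le (k : ℕ) : 𝒜.successProb (k + 1) 1 ≤ properProb 𝒜.wordProb k := by
  classical
  have hnn (φ : Fin (k + 1) → C) : 0 ≤ 𝒜.outputProb (k + 1) 1 φ :=
    Finset.sum_nonneg fun x _ => by positivity
  have hsum (ψ : Fin k → C) :
      ∑ c, 𝒜.outputProb (k + 1) 1 (Fin.cons c ψ : Fin (k + 1) → C) =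
        𝒜.wordProb (List.ofFn ψ) := by
    apply Complex.ofReal_injective
    have h := 𝒜.sum_trace_append [] (List.ofFn ψ)
    rw [List.append_nil, ← coe_wordProb] at h
    rw [← h]
    push_cast
    refine Finset.sum_congr rfl fun c _ => ?_
    refine (𝒜.outputProb_one_eq_trace k (Fin.cons c ψ : Fin (k + 1) → C)).trans ?_
    simp [List.ofFn_succ, List.map_ofFn, Function.comp_def]
  rw [successProb, properProb, sumWords_eq_sum_ofFn, Finset.sum_filter]
  change ∑ φ : Fin (k + 1) → C, _ ≤ _
  rw [← (Fin.consEquiv fun _ : Fin (k + 1) => C).sum_comp, Fintype.sum_prod_type, Finset.sum_comm]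
  refine Finset.sum_le_sum fun ψ _ => ?_
  split_ifs with h
  · rw [← hsum]
    refine Finset.sum_le_sum fun c _ => ?_
    split_ifs
    exacts [le_rfl, hnn _]
  · refine (Finset.sum_eq_zero fun c _ => if_neg fun hc => h ?_).le
    rw [List.isChain_iff_getElem]
    intro i hi
    rw [List.length_ofFn] at hi
    have := hc (⟨i + 1, by omega⟩ : Fin (k + 1))
    have e1 : (⟨i + 1, by omega⟩ : Fin (k + 1)) = Fin.succ ⟨i, by omega⟩ := rfl
    have e2 : (⟨i + 1, by omega⟩ : Fin (k + 1)) + 1 = Fin.succ ⟨i + 1, by omega⟩ := by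
      rw [← Fin.coeSucc_eq_succ]; rfl
    change (Fin.cons c ψ : Fin (k + 1) → C) ⟨i + 1, by omega⟩ ≠
      (Fin.cons c ψ : Fin (k + 1) → C) ((⟨i + 1, by omega⟩ : Fin (k + 1)) + 1) at this
    rw [e2, e1, Fin.cons_succ, Fin.cons_succ] at this
    simpa using this

end Algorithm

end OneWayRing

theorem mainTheorem5 (n : ℕ) [NeZero n] (𝒜 : OneWayRing.Algorithm (Fin 3)) :
    𝒜.successProb n 1 ≤ (1382 / 1383 : ℝ) ^ (n / 16) := by
  obtain ⟨k, rfl⟩ := Nat.exists_eq_succ_of_ne_zero (NeZero.ne n)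
  have hp := 𝒜.isOneDependent_wordProb
  calc 𝒜.successProb (k + 1) 1 ≤ OneWayRing.properProb 𝒜.wordProb k := 𝒜.successProb_one_le k
    -- Blocks of three among `k` nodes leave ample room for the exponent `(k + 1) / 16`.
    _ ≤ OneWayRing.properProb 𝒜.wordProb 2 ^ ((k + 1) / 16) := hp.properProb_le_pow _ (by omega)
    _ ≤ _ := pow_le_pow_left₀ (hp.properProb_nonneg 2) hp.properProb_two_le _
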